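/- Let $k>1$ and let $a,b,c,m,n,l$ be real numbers with $a\neq 0$. Let $T^2=(\mathbb R/2\pi\mathbb Z)^2$ carry the metric $g=dr^2+(k+\cos r)^2d\theta^2$ in the angular coordinates $(r,\theta)$, and let $S^2\subset\mathbb R^3$ be the unit sphere with its standard metric, which is $h=d\rho^2+\cos^2\rho\,d\phi^2$ in the geodesic polar coordinates $(\rho,\phi)\mapsto P(\rho,\phi)=(\sin\rho,\cos\rho\cos\phi,\cos\rho\sin\phi)$. A smooth map $\varphi$ from an open subset of $T^2$ to $S^2$ is called biharmonic if its bitension field $$\tau_2(\varphi)=\operatorname{Tr}_g\big(\nabla^{\varphi}\nabla^{\varphi}-\nabla^{\varphi}_{\nabla^{T^2}}\big)\tau(\varphi)-\operatorname{Tr}_g R^{S^2}\big(d\varphi,\tau(\varphi)\big)d\varphi$$ vanishes identically, where $\tau(\varphi)=\operatorname{Tr}_g\nabla d\varphi$ is the tension field and $R(X,Y)Z=\nabla_X\nabla_YZ-\nabla_Y\nabla_XZ-\nabla_{[X,Y]}Z$. Then no map given in these coordinates by $\varphi(r,\theta)=(ar+b\theta+c,\;mr+n\theta+l)$ is biharmonic.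 More precisely: if $W\subset\mathbb R^2$ is a nonempty open set and $F:T^2\to S^2$ is a map with $F([r],[\theta])=P(ar+b\theta+c,\,mr+n\theta+l)$ for all $(r,\theta)\in W$, then $F$ is not biharmonic on the image of $W$ in $T^2$. (For $W=\mathbb R^2$ this is the statement for maps that are given by the formula on the whole torus.) -/

import Mathlib

open scoped ContDiff

noncomputable section

namespace BiharmonicTorus

/-- The coordinate space `ℝⁿ`. -/
abbrev Coord (n : ℕ) : Type := Fin n → ℝ

/-- The ambient Euclidean space of the unit sphere. -/
abbrev E3 : Type := EuclideanSpace ℝ (Fin 3)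

/-- The partial derivative `∂f/∂xⁱ` of a map on a coordinate space. -/
def pd {n : ℕ} {E : Type*} [NormedAddCommGroup E] [NormedSpace ℝ E]
    (i : Fin n) (f : Coord n → E) (x : Coord n) : E :=
  fderiv ℝ f x (Pi.single i 1)

/-- A field of symmetric matrices `(g_{ij}(x))`, the components of a Riemannian metric in local
coordinates. -/
abbrev MetricField (n : ℕ) : Type := Coord n → Matrix (Fin n) (Fin n) ℝ

/-- The Christoffel symbol
`Γᵏ_{ij} = ½ ∑_l g^{kl} (∂_i g_{jl} + ∂_j g_{il} - ∂_l g_{ij})` of the Levi-Civita connection. -/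
def christoffel {n : ℕ} (g : MetricField n) (k i j : Fin n) (x : Coord n) : ℝ :=
  (1 / 2) * ∑ l, (g x)⁻¹ k l *
    (pd i (fun y => g y j l) x + pd j (fun y => g y i l) x - pd l (fun y => g y i j) x)

/-- The component `R^s_{d a b}` of the Riemann curvature: `R(∂_a, ∂_b) ∂_d = ∑_s R^s_{d a b} ∂_s`,
where `R(X, Y) Z = ∇_X ∇_Y Z - ∇_Y ∇_X Z - ∇_{[X, Y]} Z`. -/
def riemann {n : ℕ} (h : MetricField n) (s d a b : Fin n) (y : Coord n) : ℝ :=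
  pd a (christoffel h s b d) y - pd b (christoffel h s a d) y
    + ∑ e, (christoffel h s a e y * christoffel h e b d y
        - christoffel h s b e y * christoffel h e a d y)

/-- The pull-back connection of a map with coordinate expression `u` into a manifold with metric
`h`. For a section `V = ∑ V^s ∂_s` of the pull-back bundle,
`(∇_{∂_i} V)^s = ∂_i V^s + ∑_{p,q} Γ^s_{pq}(u) ∂_i u^p V^q`. -/
def covDeriv {m n : ℕ} (h : MetricField n) (u : Coord m → Coord n) (i : Fin m)
    (V : Coord m → Coord n) (x : Coord m) : Coord n := fun s =>
  pd i (fun z => V z s) x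
    + ∑ p, ∑ q, christoffel h s p q (u x) * pd i (fun z => u z p) x * V x q

/-- The components of the vector `R(X, Y) Z` at the point `y`. -/
def curv {n : ℕ} (h : MetricField n) (y X Y Z : Coord n) : Coord n := fun s =>
  ∑ d, ∑ a, ∑ b, riemann h s d a b y * X a * Y b * Z d

/-- The tension field `τ = Tr_g ∇du`, that is
`τ = ∑_{i,j} g^{ij} (∇_{∂_i} (du ∂_j) - ∑_k Γᵏ_{ij} du ∂_k)`. -/
def tension {m n : ℕ} (g : MetricField m) (h : MetricField n) (u : Coord m → Coord n)
    (x : Coord m) : Coord n :=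
  ∑ i, ∑ j, (g x)⁻¹ i j •
    (covDeriv h u i (pd j u) x - ∑ k, christoffel g k i j x • pd k u x)

/-- The bitension field
`τ₂ = Tr_g (∇∇ - ∇_{∇^M}) τ - Tr_g R(du, τ) du`, that is
`τ₂ = ∑_{i,j} g^{ij} (∇_{∂_i} ∇_{∂_j} τ - ∑_k Γᵏ_{ij} ∇_{∂_k} τ - R(du ∂_i, τ) (du ∂_j))`. -/
def bitension {m n : ℕ} (g : MetricField m) (h : MetricField n) (u : Coord m → Coord n)
    (x : Coord m) : Coord n :=
  ∑ i, ∑ j, (g x)⁻¹ i j •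
    (covDeriv h u i (covDeriv h u j (tension g h u)) x
      - ∑ k, christoffel g k i j x • covDeriv h u k (tension g h u) x
      - curv h (u x) (pd i u x) (tension g h u x) (pd j u x))

/-- The torus `T² = (ℝ / 2πℤ) × (ℝ / 2πℤ)`. -/
abbrev Torus : Type := Real.Angle × Real.Angle

/-- The point of the torus with angular coordinates `(r, θ) = (x 0, x 1)`. -/
def toTorus (x : Coord 2) : Torus := ((x 0 : Real.Angle), (x 1 : Real.Angle))

/-- The metric `dr² + (k + cos r)² dθ²` on the torus, in the angular coordinates `(r, θ)`. -/
def torusMetric (k : ℝ) : MetricField 2 := fun x =>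
  Matrix.diagonal ![1, (k + Real.cos (x 0)) ^ 2]

/-- The unit sphere `S²` of Euclidean 3-space. -/
abbrev Sphere2 : Type := Metric.sphere (0 : E3) 1

/-- The point `(sin ρ, cos ρ cos φ, cos ρ sin φ)` of the unit sphere with geodesic polar
coordinates `(ρ, φ)`; in these coordinates the metric of the sphere is `dρ² + cos² ρ dφ²`. -/
def polarPoint (ρ φ : ℝ) : Sphere2 :=
  ⟨!₂[Real.sin ρ, Real.cos ρ * Real.cos φ, Real.cos ρ * Real.sin φ], by
    have h1 := Real.sin_sq_add_cos_sq ρ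
    have h2 := Real.sin_sq_add_cos_sq φ
    rw [mem_sphere_zero_iff_norm, EuclideanSpace.norm_eq, Real.sqrt_eq_one]
    simp only [Fin.sum_univ_three, Real.norm_eq_abs, sq_abs]
    simp
    linear_combination h1 + Real.cos ρ ^ 2 * h2⟩

/-- `X`, restricted to the open set `V`, is a smooth regular parametrization of a piece of the
unit sphere (an immersion, hence locally the inverse of a chart of `S²`). -/
structure IsSphereParam (V : Set (Coord 2)) (X : Coord 2 → E3) : Prop where
  isOpen : IsOpen V
  smooth : ContDiffOn ℝ ∞ X V
  mem_sphere : ∀ y ∈ V, X y ∈ Metric.sphere (0 : E3) 1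
  regular : ∀ y ∈ V, Function.Injective (fderiv ℝ X y)

/-- The components `h_{ab} = ⟨∂_a X, ∂_b X⟩` of the standard metric of the sphere in the local
coordinates given by a parametrization `X`. -/
def inducedMetric (X : Coord 2 → E3) : MetricField 2 := fun y =>
  Matrix.of fun a b => inner ℝ (pd a X y) (pd b X y)

/-- Let the torus carry the metric with components `g` in the angular coordinates `(r, θ)` (so `g`
is `2π`-periodic in both variables), and let `S²` carry its standard metric. The map `F` is
biharmonic on the open subset `D` of the torus if it is smooth there and its bitension field
vanishes there: for all local coordinates on the sphere, the bitension field of the coordinate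
expression `u` of `F` is zero wherever that expression is defined. -/
def IsBiharmonicOn (g : MetricField 2) (F : Torus → Sphere2) (D : Set Torus) : Prop :=
  ContDiffOn ℝ ∞ (fun x => (F (toTorus x) : E3)) (toTorus ⁻¹' D) ∧
  ∀ (V : Set (Coord 2)) (X : Coord 2 → E3), IsSphereParam V X →
    ∀ (U : Set (Coord 2)) (u : Coord 2 → Coord 2),
      IsOpen U → U ⊆ toTorus ⁻¹' D → ContDiffOn ℝ ∞ u U → Set.MapsTo u U V →
      (∀ x ∈ U, X (u x) = F (toTorus x)) →
      ∀ x ∈ U, bitension g (inducedMetric X) u x = 0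

end BiharmonicTorus

end

/-!
Over the part of `W` where `cos ρ ≠ 0` the polar coordinates `(ρ, φ)` are admissible on the sphere,
and there the coordinate expression of `F` is the affine map `affineCoordMap`. Both metrics have the
form `dy₀² + w(y₀)² dy₁²` (`warpedMetric`), and with respect to the orthonormal frame `∂_ρ`,
`(cos ρ)⁻¹ ∂_φ` the pull-back connection has no singular coefficients
(`covDeriv_sphereMetric`). With `f = k + cos r`, the tension field has the frame components

  `A = -a sin r / f + sin ρ cos ρ (m² + n² / f²)`,
  `B = -m cos ρ sin r / f - 2 sin ρ (a m + b n / f²)`,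

and, multiplied by a power of `f`, the frame components of the bitension field are polynomials in
`cos r`, `sin r`, `cos ρ`, `sin ρ`: `bitensionRhoPoly` is `f⁴` times the first one, and
`bitensionPhiPoly` is `f³` times the second one in the case `b = 0`
(`bitension_affineCoordMap_eq`).

If these vanish along a segment on which `ρ` is an affine function of `r`, then by the identity
theorem they vanish for all complex `r`, in particular at the zeros `r = π + 2πj + i arcosh k` of
`f`, where the terms of the highest pole order of the bitension field survive.

* If `n = 0`, then `bitensionRhoPoly` is divisible by `f`, and the quotient has the value
  `a (k² - 1) sin r ≠ 0` at a zero of `f` (`n_ne_zero`).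
* If `b ≠ 0`, then `r` and `ρ` are independent, and fixing `ρ` gives
  `sin ρ cos ρ n² (-4 (k² - 1) - 8 b² + n² cos 2ρ) = 0` for all `ρ`, so `n = 0`
  (`n_eq_zero_of_independent`).
* If `b = 0` and `n ≠ 0`, then `ρ = a r + γ` with `γ` constant. At the zeros of `f` one finds
  `n² cos 2ρ = 4 (k² - 1)`. As `Im ρ ≠ 0` there, `Re 2ρ` is a multiple of `2π`, whence `2 a` is an
  integer `N`; moreover `m = 0` (`double_angle_at_radius_zero`). Now `bitensionRhoPoly` is odd about
  the points `r = π` and `r = 2π`, and its derivatives there (`deriv_at_symmetric_point`) give two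
  real equations for `k` and `n²`. These lead to `1 + 4 N² = 2 N⁴`, impossible by parity, or
  contradict `k > 1` (`no_symmetric_solution`); so `n = 0`
  (`n_eq_zero_of_b_zero`), contradicting the first case.
-/

noncomputable section

namespace BiharmonicTorus

/-! ### Partial derivatives and warped product metrics -/

theorem pd_eq_of_hasDerivAt {n : ℕ} {i : Fin n} {f : Coord n → ℝ} {x : Coord n} {d : ℝ}
    (hf : DifferentiableAt ℝ f x)
    (h : HasDerivAt (fun t : ℝ => f (x + t • Pi.single i 1)) d 0) : pd i f x = d := by
  have hx : x = x + (0 : ℝ) • (Pi.single i 1 : Coord n) := by simp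
  have hl : HasDerivAt (fun t : ℝ => x + t • (Pi.single i 1 : Coord n)) (Pi.single i 1) 0 := by
    simpa using ((hasDerivAt_id (0 : ℝ)).smul_const (Pi.single i 1 : Coord n)).const_add x
  have h1 : HasFDerivAt f (fderiv ℝ f x) (x + (0 : ℝ) • (Pi.single i 1 : Coord n)) := by
    rw [← hx]; exact hf.hasFDerivAt
  exact (h1.comp_hasDerivAt 0 hl).unique h

theorem pd_congr {n : ℕ} {E : Type*} [NormedAddCommGroup E] [NormedSpace ℝ E] {i : Fin n}
    {f g : Coord n → E} {x : Coord n} (h : f =ᶠ[nhds x] g) : pd i f x = pd i g x := by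
  unfold pd; rw [h.fderiv_eq]

@[simp] theorem pd_const {n : ℕ} {E : Type*} [NormedAddCommGroup E] [NormedSpace ℝ E] {i : Fin n}
    (v : E) (x : Coord n) : pd i (fun _ => v) x = 0 := by
  simp [pd]

/-- The warped product metric `dy₀² + w(y₀)² dy₁²`. The torus has `w = k + cos`, the sphere in
polar coordinates has `w = cos`. -/
def warpedMetric (w : ℝ → ℝ) : MetricField 2 := fun y => Matrix.diagonal ![1, w (y 0) ^ 2]

theorem pd_zero_comp {w : ℝ → ℝ} {y : Coord 2} {d : ℝ} (hw : HasDerivAt w d (y 0)) :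
    pd 0 (fun z : Coord 2 => w (z 0)) y = d := by
  apply pd_eq_of_hasDerivAt
  · exact hw.differentiableAt.comp y (by fun_prop)
  · have h1 : HasDerivAt (fun t : ℝ => y 0 + t) 1 0 := by
      simpa using (hasDerivAt_id (0 : ℝ)).const_add (y 0)
    have h2 : HasDerivAt w d (y 0 + 0) := by simpa using hw
    simpa [Function.comp_def] using h2.comp (0 : ℝ) h1

theorem pd_one_comp {w : ℝ → ℝ} {y : Coord 2} (hw : DifferentiableAt ℝ w (y 0)) :
    pd 1 (fun z : Coord 2 => w (z 0)) y = 0 := by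
  apply pd_eq_of_hasDerivAt
  · exact hw.comp y (by fun_prop)
  · simpa using hasDerivAt_const (0 : ℝ) (w (y 0))

theorem warpedMetric_inv {w : ℝ → ℝ} {y : Coord 2} (h0 : w (y 0) ≠ 0) :
    (warpedMetric w y)⁻¹ = Matrix.diagonal ![1, (w (y 0) ^ 2)⁻¹] := by
  apply Matrix.inv_eq_right_inv
  rw [warpedMetric, Matrix.diagonal_mul_diagonal, ← Matrix.diagonal_one]
  congr 1
  funext i
  fin_cases i <;> simp [h0]

theorem christoffel_warpedMetric {w : ℝ → ℝ} {y : Coord 2} {d : ℝ}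
    (hw : HasDerivAt w d (y 0)) (h0 : w (y 0) ≠ 0) (k i j : Fin 2) :
    christoffel (warpedMetric w) k i j y =
      if k = 0 then (if i = 1 ∧ j = 1 then -(w (y 0) * d) else 0)
      else (if i = j then 0 else d / w (y 0)) := by
  have e00 : (fun z : Coord 2 => warpedMetric w z 0 0) = fun _ => 1 := by
    funext z; simp [warpedMetric]
  have e01 : (fun z : Coord 2 => warpedMetric w z 0 1) = fun _ => 0 := by
    funext z; simp [warpedMetric]
  have e10 : (fun z : Coord 2 => warpedMetric w z 1 0) = fun _ => 0 := by
    funext z; simp [warpedMetric]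
  have e11 : (fun z : Coord 2 => warpedMetric w z 1 1) = fun z => (fun r => w r ^ 2) (z 0) := by
    funext z; simp [warpedMetric]
  have hw2 : HasDerivAt (fun r => w r ^ 2) (2 * w (y 0) * d) (y 0) := by
    simpa using hw.fun_pow 2
  have p0 := pd_zero_comp hw2
  have p1 := pd_one_comp (y := y) hw2.differentiableAt
  unfold christoffel
  rw [warpedMetric_inv h0]
  fin_cases k <;> fin_cases i <;> fin_cases j <;>
    simp [Fin.sum_univ_two, e00, e01, e10, e11, p0, p1]
  all_goals field_simp

/-- The metric `dρ² + cos² ρ dφ²` of the unit sphere in geodesic polar coordinates. -/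
def sphereMetric : MetricField 2 := warpedMetric Real.cos

theorem christoffel_sphereMetric {y : Coord 2} (h0 : Real.cos (y 0) ≠ 0) (k i j : Fin 2) :
    christoffel sphereMetric k i j y =
      if k = 0 then (if i = 1 ∧ j = 1 then Real.cos (y 0) * Real.sin (y 0) else 0)
      else (if i = j then 0 else -Real.sin (y 0) / Real.cos (y 0)) := by
  rw [sphereMetric, christoffel_warpedMetric (Real.hasDerivAt_cos _) h0]
  simp

theorem eventually_christoffel_sphereMetric {y : Coord 2} (h0 : Real.cos (y 0) ≠ 0)
    (k i j : Fin 2) :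
    christoffel sphereMetric k i j =ᶠ[nhds y] fun z =>
      (fun r => if k = 0 then (if i = 1 ∧ j = 1 then Real.cos r * Real.sin r else 0)
      else (if i = j then 0 else -Real.sin r / Real.cos r)) (z 0) := by
  have : ∀ᶠ z : Coord 2 in nhds y, Real.cos (z 0) ≠ 0 :=
    ContinuousAt.eventually_ne (g := fun z : Coord 2 => Real.cos (z 0))
      (Real.continuous_cos.comp (continuous_apply 0)).continuousAt h0
  filter_upwards [this] with z hz using christoffel_sphereMetric hz k i j

theorem pd_christoffel_sphereMetric {y : Coord 2} (h0 : Real.cos (y 0) ≠ 0) (l k i j : Fin 2) :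
    pd l (christoffel sphereMetric k i j) y =
      if l = 1 then 0 else
      if k = 0 then (if i = 1 ∧ j = 1 then Real.cos (y 0) ^ 2 - Real.sin (y 0) ^ 2 else 0)
      else (if i = j then 0 else -1 / Real.cos (y 0) ^ 2) := by
  rw [pd_congr (eventually_christoffel_sphereMetric h0 k i j)]
  have key : HasDerivAt (fun r => if k = 0 then
        (if i = 1 ∧ j = 1 then Real.cos r * Real.sin r else 0)
      else (if i = j then 0 else -Real.sin r / Real.cos r))
      (if k = 0 then (if i = 1 ∧ j = 1 then Real.cos (y 0) ^ 2 - Real.sin (y 0) ^ 2 else 0)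
      else (if i = j then 0 else -1 / Real.cos (y 0) ^ 2)) (y 0) := by
    split_ifs
    · refine ((Real.hasDerivAt_cos (y 0)).fun_mul (Real.hasDerivAt_sin (y 0))).congr_deriv ?_
      ring
    · exact hasDerivAt_const _ _
    · exact hasDerivAt_const _ _
    · refine ((Real.hasDerivAt_sin (y 0)).fun_neg.fun_div
        (Real.hasDerivAt_cos (y 0)) h0).congr_deriv ?_
      have := Real.sin_sq_add_cos_sq (y 0)
      congr 1
      linear_combination -this
  fin_cases l
  · simpa using pd_zero_comp key
  · simpa using pd_one_comp key.differentiableAt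

/-- The sphere has constant curvature one: `R(X, Y) Z = ⟨Y, Z⟩ X - ⟨X, Z⟩ Y`. -/
theorem curv_sphereMetric {y : Coord 2} (h0 : Real.cos (y 0) ≠ 0) (X Y Z : Coord 2) :
    curv sphereMetric y X Y Z =
      (Y 0 * Z 0 + Real.cos (y 0) ^ 2 * (Y 1 * Z 1)) • X -
        (X 0 * Z 0 + Real.cos (y 0) ^ 2 * (X 1 * Z 1)) • Y := by
  have := Real.sin_sq_add_cos_sq (y 0)
  funext i
  unfold curv riemann
  simp only [pd_christoffel_sphereMetric h0, christoffel_sphereMetric h0]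
  fin_cases i <;> simp [Fin.sum_univ_two]
  · field_simp
    ring
  · field_simp
    linear_combination ((X 0 * Y 1 * Z 0) - X 1 * Y 0 * Z 0) * this

/-- The pull-back connection in the orthonormal frame `e₀ = ∂_ρ`, `e₁ = (cos ρ)⁻¹ ∂_φ`: for
`V = A e₀ + B e₁` one has `∇_i V = (∂_i A + sin ρ ∂_i φ B) e₀ + (∂_i B - sin ρ ∂_i φ A) e₁`. -/
theorem covDeriv_sphereMetric {u : Coord 2 → Coord 2} {i : Fin 2} {V : Coord 2 → Coord 2}
    {A B : Coord 2 → ℝ} {x : Coord 2} (h0 : Real.cos (u x 0) ≠ 0)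
    (hu : DifferentiableAt ℝ (fun z => u z 0) x)
    (hV : V =ᶠ[nhds x] fun z => ![A z, B z / Real.cos (u z 0)])
    (hB : DifferentiableAt ℝ B x) :
    covDeriv sphereMetric u i V x =
      ![pd i A x + Real.sin (u x 0) * pd i (fun z => u z 1) x * B x,
        (pd i B x - Real.sin (u x 0) * pd i (fun z => u z 1) x * A x) / Real.cos (u x 0)] := by
  have e0 : pd i (fun z => V z 0) x = pd i A x :=
    pd_congr (hV.mono fun z hz => by simp [hz])
  have e1 : pd i (fun z => V z 1) x = pd i (fun z => B z / Real.cos (u z 0)) x :=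
    pd_congr (hV.mono fun z hz => by simp [hz])
  have e2 : pd i (fun z => B z / Real.cos (u z 0)) x =
      pd i B x / Real.cos (u x 0) +
        B x * (Real.sin (u x 0) * pd i (fun z => u z 0) x) / Real.cos (u x 0) ^ 2 := by
    have h1 := hB.hasFDerivAt.fun_mul ((hasDerivAt_inv h0).comp_hasFDerivAt x hu.hasFDerivAt.cos)
    have h2 : (fun z => B z / Real.cos (u z 0)) =
        (fun z => B z * (Inv.inv ∘ fun z => Real.cos (u z 0)) z) := by
      funext z; simp [div_eq_mul_inv]
    unfold pd
    rw [h2, h1.fderiv]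
    simp
    field_simp
    ring
  have v0 : V x = ![A x, B x / Real.cos (u x 0)] := hV.self_of_nhds
  funext j
  unfold covDeriv
  simp only [christoffel_sphereMetric h0]
  fin_cases j
  · simp [Fin.sum_univ_two, e0, v0]
    field_simp
  · simp [Fin.sum_univ_two, e1, e2, v0]
    field_simp
    ring

/-! ### The polar parametrization of the sphere -/

theorem hasFDerivAt_polarPoint (y : Coord 2) :
    HasFDerivAt (fun y : Coord 2 => (polarPoint (y 0) (y 1) : E3))
      ((ContinuousLinearMap.proj 0 : Coord 2 →L[ℝ] ℝ).smulRight
        (!₂[Real.cos (y 0), -Real.sin (y 0) * Real.cos (y 1),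
          -Real.sin (y 0) * Real.sin (y 1)] : E3)
      + (ContinuousLinearMap.proj 1 : Coord 2 →L[ℝ] ℝ).smulRight
        (!₂[0, -Real.cos (y 0) * Real.sin (y 1), Real.cos (y 0) * Real.cos (y 1)] : E3)) y := by
  rw [← hasFDerivWithinAt_univ, hasFDerivWithinAt_euclidean]
  simp only [hasFDerivWithinAt_univ]
  have h0 : HasFDerivAt (fun y : Coord 2 => y 0) (ContinuousLinearMap.proj 0 : Coord 2 →L[ℝ] ℝ) y :=
    (ContinuousLinearMap.proj 0 : Coord 2 →L[ℝ] ℝ).hasFDerivAt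
  have h1 : HasFDerivAt (fun y : Coord 2 => y 1) (ContinuousLinearMap.proj 1 : Coord 2 →L[ℝ] ℝ) y :=
    (ContinuousLinearMap.proj 1 : Coord 2 →L[ℝ] ℝ).hasFDerivAt
  intro i
  fin_cases i
  · refine h0.sin.congr_fderiv ?_
    ext v; simp; try ring
  · refine (h0.cos.fun_mul h1.cos).congr_fderiv ?_
    ext v; simp; try ring
  · refine (h0.cos.fun_mul h1.sin).congr_fderiv ?_
    ext v; simp; try ring

theorem isSphereParam_polarPoint :
    IsSphereParam {y | Real.cos (y 0) ≠ 0} (fun y => (polarPoint (y 0) (y 1) : E3)) where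
  isOpen := isOpen_ne_fun (Real.continuous_cos.comp (continuous_apply 0)) continuous_const
  smooth := by
    apply ContDiff.contDiffOn
    rw [contDiff_euclidean]
    intro i
    fin_cases i <;> simp [polarPoint] <;> fun_prop
  mem_sphere := fun y _ => (polarPoint (y 0) (y 1)).2
  regular := by
    intro y hy
    rw [(hasFDerivAt_polarPoint y).fderiv, injective_iff_map_eq_zero]
    intro v hv
    have e0 := congrArg (fun z : E3 => z 0) hv
    have e1 := congrArg (fun z : E3 => z 1) hv
    have e2 := congrArg (fun z : E3 => z 2) hv
    simp at e0 e1 e2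
    have hy' : Real.cos (y 0) ≠ 0 := hy
    have v0 : v 0 = 0 := by simpa [hy'] using e0
    have v1 : v 1 * Real.cos (y 0) = 0 := by
      have := Real.sin_sq_add_cos_sq (y 1)
      rw [v0] at e1 e2
      linear_combination (-(v 1) * Real.cos (y 0)) * this - Real.sin (y 1) * e1 +
        Real.cos (y 1) * e2
    ext i
    fin_cases i
    · simpa using v0
    · simpa [hy'] using v1

theorem inducedMetric_polarPoint :
    inducedMetric (fun y => (polarPoint (y 0) (y 1) : E3)) = sphereMetric := by
  funext y
  have h1 := Real.sin_sq_add_cos_sq (y 0)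
  have h2 := Real.sin_sq_add_cos_sq (y 1)
  ext i j
  simp only [inducedMetric, pd, (hasFDerivAt_polarPoint y).fderiv, sphereMetric, warpedMetric]
  fin_cases i <;> fin_cases j <;> simp [PiLp.inner_apply, Fin.sum_univ_three]
  · linear_combination h1 + Real.sin (y 0) ^ 2 * h2
  · ring
  · ring
  · linear_combination Real.cos (y 0) ^ 2 * h2

/-! ### Calculus of partial derivatives -/

/-- `f` is differentiable at `x` with partial derivatives `p = ∂₀ f` and `q = ∂₁ f`. -/
def HasPartials (f : Coord 2 → ℝ) (p q : ℝ) (x : Coord 2) : Prop :=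
  HasFDerivAt f (p • (ContinuousLinearMap.proj 0 : Coord 2 →L[ℝ] ℝ) +
    q • (ContinuousLinearMap.proj 1 : Coord 2 →L[ℝ] ℝ)) x

namespace HasPartials
variable {f g : Coord 2 → ℝ} {p q p' q' : ℝ} {x : Coord 2}

theorem differentiableAt (h : HasPartials f p q x) : DifferentiableAt ℝ f x :=
  HasFDerivAt.differentiableAt h

theorem pd_zero (h : HasPartials f p q x) : pd 0 f x = p := by
  unfold pd; rw [HasFDerivAt.fderiv h]; simp

theorem pd_one (h : HasPartials f p q x) : pd 1 f x = q := by
  unfold pd; rw [HasFDerivAt.fderiv h]; simp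

theorem congr (h : HasPartials f p q x) (hp : p = p') (hq : q = q') : HasPartials f p' q' x := by
  subst hp hq; exact h

theorem const (r : ℝ) : HasPartials (fun _ => r) 0 0 x :=
  (hasFDerivAt_const r x).congr_fderiv (by simp)

theorem coord_zero : HasPartials (fun x => x 0) 1 0 x :=
  ((ContinuousLinearMap.proj 0 : Coord 2 →L[ℝ] ℝ).hasFDerivAt (x := x)).congr_fderiv (by simp)

theorem coord_one : HasPartials (fun x => x 1) 0 1 x :=
  ((ContinuousLinearMap.proj 1 : Coord 2 →L[ℝ] ℝ).hasFDerivAt (x := x)).congr_fderiv (by simp)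

theorem add (hf : HasPartials f p q x) (hg : HasPartials g p' q' x) :
    HasPartials (fun x => f x + g x) (p + p') (q + q') x := by
  refine (HasFDerivAt.fun_add hf hg).congr_fderiv ?_
  module

theorem sub (hf : HasPartials f p q x) (hg : HasPartials g p' q' x) :
    HasPartials (fun x => f x - g x) (p - p') (q - q') x := by
  refine (HasFDerivAt.fun_sub hf hg).congr_fderiv ?_
  module

theorem mul (hf : HasPartials f p q x) (hg : HasPartials g p' q' x) :
    HasPartials (fun x => f x * g x) (p * g x + f x * p') (q * g x + f x * q') x := by
  refine (HasFDerivAt.fun_mul hf hg).congr_fderiv ?_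
  module

theorem sq (hf : HasPartials f p q x) :
    HasPartials (fun x => f x ^ 2) (2 * f x * p) (2 * f x * q) x := by
  simpa only [pow_two] using (hf.mul hf).congr (by ring) (by ring)

theorem cube (hf : HasPartials f p q x) :
    HasPartials (fun x => f x ^ 3) (3 * f x ^ 2 * p) (3 * f x ^ 2 * q) x := by
  simpa only [← pow_succ'] using (hf.mul hf.sq).congr (by ring) (by ring)

theorem const_mul (r : ℝ) (hf : HasPartials f p q x) :
    HasPartials (fun x => r * f x) (r * p) (r * q) x :=
  ((const r).mul hf).congr (by ring) (by ring)

theorem comp {φ : ℝ → ℝ} {d : ℝ} (hφ : HasDerivAt φ d (f x)) (hf : HasPartials f p q x) :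
    HasPartials (fun x => φ (f x)) (d * p) (d * q) x := by
  refine (hφ.comp_hasFDerivAt x hf).congr_fderiv ?_
  module

end HasPartials

/-- `covDeriv_sphereMetric` for a map whose partial derivatives are given. -/
theorem covDeriv_frame {u : Coord 2 → Coord 2} {V : Coord 2 → Coord 2}
    {A B : Coord 2 → ℝ} {x : Coord 2} {a b m n A₀ A₁ B₀ B₁ : ℝ} (h0 : Real.cos (u x 0) ≠ 0)
    (hu₀ : HasPartials (fun z => u z 0) a b x) (hu₁ : HasPartials (fun z => u z 1) m n x)
    (hV : V =ᶠ[nhds x] fun z => ![A z, B z / Real.cos (u z 0)])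
    (hA : HasPartials A A₀ A₁ x) (hB : HasPartials B B₀ B₁ x) :
    covDeriv sphereMetric u 0 V x =
      ![A₀ + Real.sin (u x 0) * m * B x, (B₀ - Real.sin (u x 0) * m * A x) / Real.cos (u x 0)] ∧
    covDeriv sphereMetric u 1 V x =
      ![A₁ + Real.sin (u x 0) * n * B x, (B₁ - Real.sin (u x 0) * n * A x) / Real.cos (u x 0)] := by
  rw [covDeriv_sphereMetric h0 hu₀.differentiableAt hV hB.differentiableAt,
    covDeriv_sphereMetric h0 hu₀.differentiableAt hV hB.differentiableAt,
    hA.pd_zero, hA.pd_one, hB.pd_zero, hB.pd_one, hu₁.pd_zero, hu₁.pd_one]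
  exact ⟨rfl, rfl⟩

theorem pd_eq_of_hasPartials {u : Coord 2 → Coord 2} {x : Coord 2} {a b m n : ℝ}
    (hu₀ : HasPartials (fun z => u z 0) a b x) (hu₁ : HasPartials (fun z => u z 1) m n x) :
    pd 0 u x = ![a, m] ∧ pd 1 u x = ![b, n] := by
  have hu : DifferentiableAt ℝ u x := by
    rw [differentiableAt_pi]
    intro i
    fin_cases i
    · exact hu₀.differentiableAt
    · exact hu₁.differentiableAt
  have h (i j : Fin 2) : pd i u x j = pd i (fun z => u z j) x := by
    unfold pd
    rw [fderiv_apply hu]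
    rfl
  constructor
  · ext j
    fin_cases j
    · simpa [hu₀.pd_zero] using h 0 0
    · simpa [hu₁.pd_zero] using h 0 1
  · ext j
    fin_cases j
    · simpa [hu₀.pd_one] using h 1 0
    · simpa [hu₁.pd_one] using h 1 1

/-! ### The tension field -/

theorem christoffel_torusMetric {k : ℝ} {x : Coord 2} (hf : k + Real.cos (x 0) ≠ 0)
    (l i j : Fin 2) :
    christoffel (torusMetric k) l i j x =
      if l = 0 then (if i = 1 ∧ j = 1 then (k + Real.cos (x 0)) * Real.sin (x 0) else 0)
      else (if i = j then 0 else -Real.sin (x 0) / (k + Real.cos (x 0))) := by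
  have := christoffel_warpedMetric (w := fun r => k + Real.cos r)
    ((Real.hasDerivAt_cos (x 0)).const_add k) hf l i j
  simp only [mul_neg, neg_neg] at this
  exact this

theorem torusMetric_inv {k : ℝ} {x : Coord 2} (hf : k + Real.cos (x 0) ≠ 0) :
    (torusMetric k x)⁻¹ = Matrix.diagonal ![1, ((k + Real.cos (x 0)) ^ 2)⁻¹] :=
  warpedMetric_inv (w := fun r => k + Real.cos r) hf

/-- The map `(r, θ) ↦ (a r + b θ + c, m r + n θ + l)` between coordinate spaces. -/
def affineCoordMap (a b c m n l : ℝ) (x : Coord 2) : Coord 2 :=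
  ![a * x 0 + b * x 1 + c, m * x 0 + n * x 1 + l]

theorem hasPartials_affine (a b c : ℝ) (x : Coord 2) :
    HasPartials (fun x => a * x 0 + b * x 1 + c) a b x :=
  (((HasPartials.coord_zero.const_mul a).add (HasPartials.coord_one.const_mul b)).add
    (HasPartials.const c)).congr (by ring) (by ring)

/-- The component of the tension field of `affineCoordMap` along `∂_ρ`, where `ρ` is the first
component of that map. -/
def tensionRho (k a m n : ℝ) (ρ : Coord 2 → ℝ) (x : Coord 2) : ℝ :=
  -a * (Real.sin (x 0) * (k + Real.cos (x 0))⁻¹) +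
    Real.sin (ρ x) * Real.cos (ρ x) *
      (m ^ 2 + n ^ 2 * ((k + Real.cos (x 0))⁻¹ * (k + Real.cos (x 0))⁻¹))

/-- The component of the tension field of `affineCoordMap` along the unit vector
`(cos ρ)⁻¹ ∂_φ`. -/
def tensionPhi (k a b m n : ℝ) (ρ : Coord 2 → ℝ) (x : Coord 2) : ℝ :=
  -m * (Real.cos (ρ x) * (Real.sin (x 0) * (k + Real.cos (x 0))⁻¹)) -
    2 * (Real.sin (ρ x) *
      (a * m + b * n * ((k + Real.cos (x 0))⁻¹ * (k + Real.cos (x 0))⁻¹)))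

theorem tension_affineCoordMap {k a b c m n l : ℝ} {x : Coord 2} (hf : k + Real.cos (x 0) ≠ 0)
    (h0 : Real.cos (a * x 0 + b * x 1 + c) ≠ 0) :
    tension (torusMetric k) sphereMetric (affineCoordMap a b c m n l) x =
      ![tensionRho k a m n (fun x => a * x 0 + b * x 1 + c) x,
        tensionPhi k a b m n (fun x => a * x 0 + b * x 1 + c) x /
          Real.cos (a * x 0 + b * x 1 + c)] := by
  have hu₀ (x) : HasPartials (fun z => affineCoordMap a b c m n l z 0) a b x :=
    hasPartials_affine a b c x
  have hu₁ (x) : HasPartials (fun z => affineCoordMap a b c m n l z 1) m n x :=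
    hasPartials_affine m n l x
  have p0 : pd 0 (affineCoordMap a b c m n l) = fun _ => ![a, m] :=
    funext fun x => (pd_eq_of_hasPartials (hu₀ x) (hu₁ x)).1
  have p1 : pd 1 (affineCoordMap a b c m n l) = fun _ => ![b, n] :=
    funext fun x => (pd_eq_of_hasPartials (hu₀ x) (hu₁ x)).2
  have q0 (a b c : ℝ) : pd 0 (fun z : Coord 2 => a * z 0 + b * z 1 + c) x = a :=
    (hasPartials_affine a b c x).pd_zero
  have q1 (a b c : ℝ) : pd 1 (fun z : Coord 2 => a * z 0 + b * z 1 + c) x = b :=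
    (hasPartials_affine a b c x).pd_one
  have h0' : Real.cos (affineCoordMap a b c m n l x 0) ≠ 0 := h0
  unfold tension covDeriv
  rw [torusMetric_inv hf]
  simp only [christoffel_torusMetric hf, christoffel_sphereMetric h0']
  ext j
  fin_cases j
  · simp [Fin.sum_univ_two, p0, p1, q0, q1, tensionRho, affineCoordMap]
    field_simp
    ring
  · simp [Fin.sum_univ_two, p0, p1, q0, q1, tensionPhi, affineCoordMap]
    field_simp
    ring

/-! ### The bitension field -/

/-- With `C, S` standing for `cos r, sin r` and `c, s` for `cos ρ, sin ρ`: the `∂_ρ` component of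
the bitension field of `affineCoordMap`, multiplied by `f⁴ = (k + C)⁴`. The coefficient ring is left
general so that the polynomial can be evaluated at complex arguments as well. -/
def bitensionRhoPoly {R : Type*} [CommRing R] (k a b m n C S c s : R) : R :=
  let f := k + C
  let P := m ^ 2 * f ^ 2 + n ^ 2
  let Q := a * m * f ^ 2 + b * n
  a * (k ^ 2 - 1) * S * f + s * c * n ^ 2 * (4 * S ^ 2 + 2 * f * C)
    + 4 * a * (c ^ 2 - s ^ 2) * n ^ 2 * S * f - a * S * f * (c ^ 2 - s ^ 2) * P
    - 4 * s * c * (a ^ 2 * f ^ 2 + b ^ 2) * P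
    + 2 * s * (m * (s * a * m * S * f ^ 3 + c * m * f ^ 2 * (-C * f - S ^ 2) - 2 * a * c * Q * f ^ 2
        - 4 * s * b * n * S * f) + n * b * (s * m * S * f - 2 * c * Q))
    + s * m * (-S * f) * (-c * m * S * f - 2 * s * Q)
    + (c ^ 2 - s ^ 2) * P * (-a * S * f + s * c * P)

/-- The component of the bitension field of `affineCoordMap` along `(cos ρ)⁻¹ ∂_φ`, multiplied by
`f³ = (k + C)³`, in the case `b = 0`; the arguments are as in `bitensionRhoPoly`. -/
def bitensionPhiPoly {R : Type*} [CommRing R] (k a m n C S c s : R) : R :=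
  let f := k + C
  let P := m ^ 2 * f ^ 2 + n ^ 2
  c * m * (k ^ 2 - 1) * S - 2 * a * m * s * f * (-C * f - S ^ 2) + 3 * a ^ 2 * c * m * S * f ^ 2
    + 2 * a ^ 3 * s * m * f ^ 3 - s * a * m * S ^ 2 * f
    - 2 * s * m * (a * f * (-C * f - S ^ 2) + a * (c ^ 2 - s ^ 2) * f * P + 2 * s * c * n ^ 2 * S)
    - 2 * c * a * m * f * (-a * S * f + s * c * P) + s * m * S * (-a * S * f + s * c * P)
    + (a ^ 2 * f ^ 2 - s ^ 2 * P) * (-c * m * S - 2 * s * a * m * f)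

theorem hasPartials_inv_radius {k : ℝ} {x : Coord 2} (hf : k + Real.cos (x 0) ≠ 0) :
    HasPartials (fun x : Coord 2 => (k + Real.cos (x 0))⁻¹)
      (Real.sin (x 0) * (k + Real.cos (x 0))⁻¹ ^ 2) 0 x :=
  (HasPartials.comp (φ := fun r => (k + Real.cos r)⁻¹)
    (((Real.hasDerivAt_cos (x 0)).const_add k).fun_inv hf) HasPartials.coord_zero).congr
    (by field_simp) (by ring)

theorem hasPartials_sin_coord (x : Coord 2) :
    HasPartials (fun x : Coord 2 => Real.sin (x 0)) (Real.cos (x 0)) 0 x :=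
  ((HasPartials.coord_zero).comp (Real.hasDerivAt_sin _)).congr (by ring) (by ring)

theorem hasPartials_cos_coord (x : Coord 2) :
    HasPartials (fun x : Coord 2 => Real.cos (x 0)) (-Real.sin (x 0)) 0 x :=
  ((HasPartials.coord_zero).comp (Real.hasDerivAt_cos _)).congr (by ring) (by ring)

/-- The derivative of `tensionRho` with respect to `r`, if `∂ρ/∂r = a`. -/
def tensionRho₀ (k a m n : ℝ) (ρ : Coord 2 → ℝ) (x : Coord 2) : ℝ :=
  -a * (Real.cos (x 0) * (k + Real.cos (x 0))⁻¹ + Real.sin (x 0) ^ 2 * (k + Real.cos (x 0))⁻¹ ^ 2)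
    + a * ((Real.cos (ρ x) ^ 2 - Real.sin (ρ x) ^ 2) *
        (m ^ 2 + n ^ 2 * (k + Real.cos (x 0))⁻¹ ^ 2))
    + 2 * n ^ 2 * (Real.sin (ρ x) * Real.cos (ρ x) *
        (Real.sin (x 0) * (k + Real.cos (x 0))⁻¹ ^ 3))

/-- The derivative of `tensionRho` with respect to `θ`, if `∂ρ/∂θ = b`. -/
def tensionRho₁ (k b m n : ℝ) (ρ : Coord 2 → ℝ) (x : Coord 2) : ℝ :=
  b * ((Real.cos (ρ x) ^ 2 - Real.sin (ρ x) ^ 2) *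
        (m ^ 2 + n ^ 2 * (k + Real.cos (x 0))⁻¹ ^ 2))

/-- The derivative of `tensionPhi` with respect to `r`, if `∂ρ/∂r = a` and `∂ρ/∂θ = b`. -/
def tensionPhi₀ (k a b m n : ℝ) (ρ : Coord 2 → ℝ) (x : Coord 2) : ℝ :=
  a * m * (Real.sin (ρ x) * (Real.sin (x 0) * (k + Real.cos (x 0))⁻¹))
    - m * (Real.cos (ρ x) * (Real.cos (x 0) * (k + Real.cos (x 0))⁻¹ +
        Real.sin (x 0) ^ 2 * (k + Real.cos (x 0))⁻¹ ^ 2))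
    - 2 * a * (Real.cos (ρ x) * (a * m + b * n * (k + Real.cos (x 0))⁻¹ ^ 2))
    - 4 * b * n * (Real.sin (ρ x) * (Real.sin (x 0) * (k + Real.cos (x 0))⁻¹ ^ 3))

/-- The derivative of `tensionPhi` with respect to `θ`, if `∂ρ/∂r = a` and `∂ρ/∂θ = b`. -/
def tensionPhi₁ (k a b m n : ℝ) (ρ : Coord 2 → ℝ) (x : Coord 2) : ℝ :=
  b * m * (Real.sin (ρ x) * (Real.sin (x 0) * (k + Real.cos (x 0))⁻¹))
    - 2 * b * (Real.cos (ρ x) * (a * m + b * n * (k + Real.cos (x 0))⁻¹ ^ 2))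

section
variable {k a b m n : ℝ} {ρ : Coord 2 → ℝ} {x : Coord 2}

theorem hasPartials_tensionRho (hf : k + Real.cos (x 0) ≠ 0) (hρ : HasPartials ρ a b x) :
    HasPartials (tensionRho k a m n ρ) (tensionRho₀ k a m n ρ x) (tensionRho₁ k b m n ρ x) x := by
  have hg := hasPartials_inv_radius hf
  have hS := hasPartials_sin_coord x
  have hs := hρ.comp (Real.hasDerivAt_sin _)
  have hc := hρ.comp (Real.hasDerivAt_cos _)
  have h := ((hS.mul hg).const_mul (-a)).add ((hs.mul hc).mul
    ((HasPartials.const (m ^ 2)).add ((hg.mul hg).const_mul (n ^ 2))))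
  exact h.congr (by simp only [tensionRho₀]; ring) (by simp only [tensionRho₁]; ring)

theorem hasPartials_tensionPhi (hf : k + Real.cos (x 0) ≠ 0) (hρ : HasPartials ρ a b x) :
    HasPartials (tensionPhi k a b m n ρ) (tensionPhi₀ k a b m n ρ x)
      (tensionPhi₁ k a b m n ρ x) x := by
  have hg := hasPartials_inv_radius hf
  have hS := hasPartials_sin_coord x
  have hs := hρ.comp (Real.hasDerivAt_sin _)
  have hc := hρ.comp (Real.hasDerivAt_cos _)
  have h := ((hc.mul (hS.mul hg)).const_mul (-m)).sub ((hs.mul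
    ((HasPartials.const (a * m)).add ((hg.mul hg).const_mul (b * n)))).const_mul 2)
  exact h.congr (by simp only [tensionPhi₀]; ring) (by simp only [tensionPhi₁]; ring)

/-- The bitension field of an affine map, cleared of denominators. Its `∂_φ` coordinate becomes a
frame component after multiplication by `cos ρ`. -/
theorem bitension_affineCoordMap_eq {c l : ℝ} (hρ : ρ = fun x => a * x 0 + b * x 1 + c)
    (hf : k + Real.cos (x 0) ≠ 0) (h0 : Real.cos (ρ x) ≠ 0) :
    (k + Real.cos (x 0)) ^ 4 *
        bitension (torusMetric k) sphereMetric (affineCoordMap a b c m n l) x 0 =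
      bitensionRhoPoly k a b m n (Real.cos (x 0)) (Real.sin (x 0)) (Real.cos (ρ x))
        (Real.sin (ρ x)) ∧
    (b = 0 → (k + Real.cos (x 0)) ^ 3 * (Real.cos (ρ x) *
        bitension (torusMetric k) sphereMetric (affineCoordMap a b c m n l) x 1) =
      bitensionPhiPoly k a m n (Real.cos (x 0)) (Real.sin (x 0)) (Real.cos (ρ x))
        (Real.sin (ρ x))) := by
  have hu₀ (x) : HasPartials (fun z => affineCoordMap a b c m n l z 0) a b x :=
    hasPartials_affine a b c x
  have hu₁ (x) : HasPartials (fun z => affineCoordMap a b c m n l z 1) m n x :=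
    hasPartials_affine m n l x
  have hρ' (x) : HasPartials ρ a b x := hρ ▸ hasPartials_affine a b c x
  have hu (x) : affineCoordMap a b c m n l x 0 = ρ x := by rw [hρ]; rfl
  have hnhds {x : Coord 2} (hf : k + Real.cos (x 0) ≠ 0) (h0 : Real.cos (ρ x) ≠ 0) :
      ∀ᶠ z in nhds x, k + Real.cos (z 0) ≠ 0 ∧ Real.cos (ρ z) ≠ 0 := by
    refine Filter.Eventually.and ?_ ?_
    · exact ContinuousAt.eventually_ne (g := fun z : Coord 2 => k + Real.cos (z 0))
        (continuous_const.add (Real.continuous_cos.comp (continuous_apply 0))).continuousAt hf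
    · exact ContinuousAt.eventually_ne (g := fun z : Coord 2 => Real.cos (ρ z))
        (Real.continuous_cos.continuousAt.comp (hρ' x).differentiableAt.continuousAt) h0
  have hτ {x : Coord 2} (hf : k + Real.cos (x 0) ≠ 0) (h0 : Real.cos (ρ x) ≠ 0) :
      tension (torusMetric k) sphereMetric (affineCoordMap a b c m n l) =ᶠ[nhds x] fun z =>
        ![tensionRho k a m n ρ z,
          tensionPhi k a b m n ρ z / Real.cos (affineCoordMap a b c m n l z 0)] := by
    filter_upwards [hnhds hf h0] with z hz
    subst hρ
    exact tension_affineCoordMap hz.1 hz.2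
  have hcov {x : Coord 2} (hf : k + Real.cos (x 0) ≠ 0) (h0 : Real.cos (ρ x) ≠ 0) :=
    covDeriv_frame (by rwa [hu]) (hu₀ x) (hu₁ x) (hτ hf h0) (hasPartials_tensionRho hf (hρ' x))
      (hasPartials_tensionPhi hf (hρ' x))
  have hg := hasPartials_inv_radius hf
  have hS := hasPartials_sin_coord x
  have hC := hasPartials_cos_coord x
  have hs := (hρ' x).comp (Real.hasDerivAt_sin _)
  have hc := (hρ' x).comp (Real.hasDerivAt_cos _)
  have hA := hasPartials_tensionRho (m := m) (n := n) hf (hρ' x)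
  have hB := hasPartials_tensionPhi (m := m) (n := n) hf (hρ' x)
  have hP := (HasPartials.const (m ^ 2)).add (hg.sq.const_mul (n ^ 2))
  have hQ := (HasPartials.const (a * m)).add (hg.sq.const_mul (b * n))
  have hA₀ : HasPartials (tensionRho₀ k a m n ρ) _ _ x :=
    ((((hC.mul hg).add (hS.sq.mul hg.sq)).const_mul (-a)).add
      (((hc.sq.sub hs.sq).mul hP).const_mul a)).add
      (((hs.mul hc).mul (hS.mul hg.cube)).const_mul (2 * n ^ 2))
  have hA₁ : HasPartials (tensionRho₁ k b m n ρ) _ _ x :=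
    ((hc.sq.sub hs.sq).mul hP).const_mul b
  have hB₀ : HasPartials (tensionPhi₀ k a b m n ρ) _ _ x :=
    ((((hs.mul (hS.mul hg)).const_mul (a * m)).sub
      ((hc.mul ((hC.mul hg).add (hS.sq.mul hg.sq))).const_mul m)).sub
      ((hc.mul hQ).const_mul (2 * a))).sub ((hs.mul (hS.mul hg.cube)).const_mul (4 * b * n))
  have hB₁ : HasPartials (tensionPhi₁ k a b m n ρ) _ _ x :=
    ((hs.mul (hS.mul hg)).const_mul (b * m)).sub ((hc.mul hQ).const_mul (2 * b))
  have hcc₀ := (covDeriv_frame (u := affineCoordMap a b c m n l) (by rwa [hu]) (hu₀ x) (hu₁ x)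
    (V := covDeriv sphereMetric (affineCoordMap a b c m n l) 0
      (tension (torusMetric k) sphereMetric (affineCoordMap a b c m n l)))
    (A := fun z => tensionRho₀ k a m n ρ z + Real.sin (ρ z) * m * tensionPhi k a b m n ρ z)
    (B := fun z => tensionPhi₀ k a b m n ρ z - Real.sin (ρ z) * m * tensionRho k a m n ρ z)
    ((hnhds hf h0).mono fun z hz => by simp only [(hcov hz.1 hz.2).1, hu])
    (hA₀.add ((hs.mul (HasPartials.const m)).mul hB))
    (hB₀.sub ((hs.mul (HasPartials.const m)).mul hA))).1
  have hcc₁ := (covDeriv_frame (u := affineCoordMap a b c m n l) (by rwa [hu]) (hu₀ x) (hu₁ x)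
    (V := covDeriv sphereMetric (affineCoordMap a b c m n l) 1
      (tension (torusMetric k) sphereMetric (affineCoordMap a b c m n l)))
    (A := fun z => tensionRho₁ k b m n ρ z + Real.sin (ρ z) * n * tensionPhi k a b m n ρ z)
    (B := fun z => tensionPhi₁ k a b m n ρ z - Real.sin (ρ z) * n * tensionRho k a m n ρ z)
    ((hnhds hf h0).mono fun z hz => by simp only [(hcov hz.1 hz.2).2, hu])
    (hA₁.add ((hs.mul (HasPartials.const n)).mul hB))
    (hB₁.sub ((hs.mul (HasPartials.const n)).mul hA))).2
  obtain ⟨p0, p1⟩ := pd_eq_of_hasPartials (hu₀ x) (hu₁ x)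
  have h0' : Real.cos (affineCoordMap a b c m n l x 0) ≠ 0 := by rwa [hu]
  have hsc := Real.sin_sq_add_cos_sq (x 0)
  have hτx := (hτ hf h0).self_of_nhds
  have hcx := hcov hf h0
  unfold bitension
  simp only [torusMetric_inv hf, christoffel_torusMetric hf, curv_sphereMetric h0',
    Fin.sum_univ_two, hcc₀, hcc₁, hτx, hcx.1, hcx.2, p0, p1, hu]
  constructor
  · simp [bitensionRhoPoly, tensionRho, tensionPhi, tensionRho₀, tensionRho₁, tensionPhi₀,
      tensionPhi₁]
    field_simp
    -- The relation `sin² r + cos² r = 1` is used for `Δ(f'/f) = (k² - 1) sin r / f³`.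
    linear_combination (-a * Real.sin (x 0) * (k + Real.cos (x 0))) * hsc
  · intro hb
    subst hb
    simp [bitensionPhiPoly, tensionRho, tensionPhi, tensionRho₀, tensionRho₁, tensionPhi₀,
      tensionPhi₁]
    field_simp
    linear_combination (-m * Real.cos (ρ x) * Real.sin (x 0)) * hsc

end

/-! ### Continuation to complex arguments -/

/-- The identity theorem for entire functions, from a real interval to the complex plane. -/
theorem eq_zero_of_eventually_real {Ψ : ℂ → ℂ} (hΨ : Differentiable ℂ Ψ) {r₁ : ℝ}
    (h : ∀ᶠ r : ℝ in nhds r₁, Ψ r = 0) (z : ℂ) : Ψ z = 0 := by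
  have ha : AnalyticOnNhd ℂ Ψ Set.univ := fun z _ => hΨ.analyticAt z
  have hfr : ∃ᶠ z in nhdsWithin (r₁ : ℂ) {(r₁ : ℂ)}ᶜ, Ψ z = (fun _ => (0 : ℂ)) z := by
    have ht : Filter.Tendsto (fun r : ℝ => (r : ℂ)) (nhdsWithin r₁ {r₁}ᶜ)
        (nhdsWithin (r₁ : ℂ) {(r₁ : ℂ)}ᶜ) := by
      refine tendsto_nhdsWithin_of_tendsto_nhds_of_eventually_within _
        (Complex.continuous_ofReal.continuousAt.tendsto.mono_left nhdsWithin_le_nhds) ?_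
      filter_upwards [self_mem_nhdsWithin] with r hr
      simpa using hr
    exact ht.frequently (h.filter_mono nhdsWithin_le_nhds).frequently
  exact congrFun (ha.eq_of_frequently_eq analyticOnNhd_const hfr) z

theorem bitensionRhoPoly_complex_eq_zero {k a b m n α γ r₁ : ℝ}
    (h : ∀ᶠ r : ℝ in nhds r₁, bitensionRhoPoly k a b m n (Real.cos r) (Real.sin r)
      (Real.cos (α * r + γ)) (Real.sin (α * r + γ)) = 0) (z : ℂ) :
    bitensionRhoPoly (k : ℂ) a b m n (Complex.cos z) (Complex.sin z)
      (Complex.cos (α * z + γ)) (Complex.sin (α * z + γ)) = 0 := by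
  refine eq_zero_of_eventually_real (Ψ := fun z => bitensionRhoPoly (k : ℂ) a b m n (Complex.cos z)
    (Complex.sin z) (Complex.cos (α * z + γ)) (Complex.sin (α * z + γ))) ?_
    (r₁ := r₁) ?_ z
  · simp only [bitensionRhoPoly]
    fun_prop
  · filter_upwards [h] with r hr
    have := congrArg (fun t : ℝ => (t : ℂ)) hr
    simpa [bitensionRhoPoly] using this

theorem bitensionPhiPoly_complex_eq_zero {k a m n α γ r₁ : ℝ}
    (h : ∀ᶠ r : ℝ in nhds r₁, bitensionPhiPoly k a m n (Real.cos r) (Real.sin r)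
      (Real.cos (α * r + γ)) (Real.sin (α * r + γ)) = 0) (z : ℂ) :
    bitensionPhiPoly (k : ℂ) a m n (Complex.cos z) (Complex.sin z)
      (Complex.cos (α * z + γ)) (Complex.sin (α * z + γ)) = 0 := by
  refine eq_zero_of_eventually_real (Ψ := fun z => bitensionPhiPoly (k : ℂ) a m n (Complex.cos z)
    (Complex.sin z) (Complex.cos (α * z + γ)) (Complex.sin (α * z + γ))) ?_
    (r₁ := r₁) ?_ z
  · simp only [bitensionPhiPoly]
    fun_prop
  · filter_upwards [h] with r hr
    have := congrArg (fun t : ℝ => (t : ℂ)) hr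
    simpa [bitensionPhiPoly] using this

/-- The radius `k + cos z` vanishes at `z = π + 2πj + i t` with `t = arcosh k`, and at its zeros
`sin² z = 1 - k² ≠ 0`. -/
theorem exists_cos_eq_neg {k : ℝ} (hk : 1 < k) :
    ∃ t : ℝ, 0 < t ∧ Real.cosh t = k ∧
      (∀ j : ℕ, Complex.cos (((Real.pi + j * (2 * Real.pi) : ℝ) : ℂ) + t * Complex.I) = -k) ∧
      ∀ z : ℂ, Complex.cos z = -k → Complex.sin z ^ 2 = 1 - k ^ 2 ∧ Complex.sin z ≠ 0 := by
  refine ⟨Real.arcosh k, Real.arcosh_pos hk, Real.cosh_arcosh hk.le, fun j => ?_, fun z hz => ?_⟩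
  · have h1 : (((Real.pi + j * (2 * Real.pi) : ℝ) : ℂ) + Real.arcosh k * Complex.I) =
        (Real.arcosh k * Complex.I + Real.pi) + j * (2 * Real.pi) := by
      push_cast; ring
    rw [h1, Complex.cos_add_nat_mul_two_pi, Complex.cos_add_pi, Complex.cos_mul_I,
      ← Complex.ofReal_cosh, Real.cosh_arcosh hk.le]
  · have h2 : Complex.sin z ^ 2 = 1 - (k : ℂ) ^ 2 := by
      have := Complex.sin_sq_add_cos_sq z
      rw [hz] at this
      linear_combination this
    refine ⟨h2, fun h0 => ?_⟩
    rw [h0] at h2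
    have h3 : (0 : ℝ) ^ 2 = 1 - k ^ 2 := by exact_mod_cast h2
    nlinarith

/-! ### The cases `n = 0` and `b ≠ 0` -/

/-- For `n = 0`, `bitensionRhoPoly` is `f (a (k² - 1) S + f L)` with `f = k + C` and this `L`. -/
def bitensionRhoRemainder {R : Type*} [CommRing R] (k a b m C S c s : R) : R :=
  let f := k + C
  a * S * (s ^ 2 - c ^ 2) * m ^ 2 * f - 4 * s * c * (a ^ 2 * f ^ 2 + b ^ 2) * m ^ 2
    + 2 * s * m * (s * a * m * S * f + c * m * (-C * f - S ^ 2) - 2 * a ^ 2 * c * m * f ^ 2)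
    - s * m * S * (-c * m * S - 2 * s * a * m * f)
    + (c ^ 2 - s ^ 2) * m ^ 2 * (-a * S * f + s * c * m ^ 2 * f ^ 2)

theorem bitensionRhoPoly_n_zero {R : Type*} [CommRing R] (k a b m C S c s : R) :
    bitensionRhoPoly k a b m 0 C S c s =
      (k + C) * (a * (k ^ 2 - 1) * S + (k + C) * bitensionRhoRemainder k a b m C S c s) := by
  simp only [bitensionRhoPoly, bitensionRhoRemainder]
  ring

/-- For `n = 0` the highest pole of the bitension field at a zero of the radius comes from
`Δ(f'/f)` alone, and its coefficient does not vanish. -/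
theorem n_ne_zero {k a b m n α γ r₁ : ℝ} (hk : 1 < k) (ha : a ≠ 0)
    (h : ∀ᶠ r : ℝ in nhds r₁, bitensionRhoPoly k a b m n (Real.cos r) (Real.sin r)
      (Real.cos (α * r + γ)) (Real.sin (α * r + γ)) = 0) : n ≠ 0 := by
  rintro rfl
  obtain ⟨t, -, -, hcos, hsin⟩ := exists_cos_eq_neg hk
  have h1 := eq_zero_of_eventually_real (Ψ := fun z => a * (k ^ 2 - 1) * Complex.sin z +
    (k + Complex.cos z) * bitensionRhoRemainder (k : ℂ) a b m (Complex.cos z)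
    (Complex.sin z) (Complex.cos (α * z + γ)) (Complex.sin (α * z + γ)))
    (by simp only [bitensionRhoRemainder]; fun_prop) (r₁ := r₁) (by
      filter_upwards [h] with r hr
      have hf : k + Real.cos r ≠ 0 := by linarith [Real.neg_one_le_cos r]
      rw [bitensionRhoPoly_n_zero] at hr
      have := congrArg (fun t : ℝ => (t : ℂ)) ((mul_eq_zero.mp hr).resolve_left hf)
      simpa [bitensionRhoRemainder] using this)
  have h3 := hcos 0
  have h4 := (hsin _ h3).2
  specialize h1 (((Real.pi + (0 : ℕ) * (2 * Real.pi) : ℝ) : ℂ) + t * Complex.I)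
  simp only [h3, add_neg_cancel, zero_mul, add_zero] at h1
  have h5 : ((a * (k ^ 2 - 1) : ℝ) : ℂ) ≠ 0 := by
    rw [Complex.ofReal_ne_zero]
    exact mul_ne_zero ha (by nlinarith)
  push_cast at h5
  exact mul_ne_zero h5 h4 h1

theorem bitensionRhoPoly_radius_zero {R : Type*} [CommRing R] (k a b m n S c s : R) :
    bitensionRhoPoly k a b m n (-k) S c s =
      s * c * n ^ 2 * (4 * S ^ 2 - 8 * b ^ 2 + (c ^ 2 - s ^ 2) * n ^ 2) := by
  simp only [bitensionRhoPoly]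
  ring

theorem bitensionPhiPoly_radius_zero {R : Type*} [CommRing R] (k a m n S c s : R) :
    bitensionPhiPoly k a m n (-k) S c s = c * m * S * (k ^ 2 - 1 - 2 * s ^ 2 * n ^ 2) := by
  simp only [bitensionPhiPoly]
  ring

/-- If `r` and `ρ` vary independently, then the leading coefficient at a zero of the radius vanishes
for all `ρ`; at `ρ = π / 4` the term with `cos 2ρ` drops out and a sum of one sign remains. -/
theorem n_eq_zero_of_independent {k a b m n r₁ ρ₁ : ℝ} (hk : 1 < k)
    (h : ∀ᶠ γ : ℝ in nhds ρ₁, ∀ᶠ r : ℝ in nhds r₁, bitensionRhoPoly k a b m n (Real.cos r)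
      (Real.sin r) (Real.cos γ) (Real.sin γ) = 0) : n = 0 := by
  obtain ⟨t, -, -, hcos, hsin⟩ := exists_cos_eq_neg hk
  have h1 := eq_zero_of_eventually_real (Ψ := fun z => Complex.sin z * Complex.cos z * n ^ 2 *
      (4 * (1 - k ^ 2) - 8 * b ^ 2 + (Complex.cos z ^ 2 - Complex.sin z ^ 2) * n ^ 2))
    (by fun_prop) (r₁ := ρ₁) (by
      filter_upwards [h] with γ hγ
      have h3 := bitensionRhoPoly_complex_eq_zero (α := 0) (γ := γ) (r₁ := r₁) (by simpa using hγ)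
        (((Real.pi + (0 : ℕ) * (2 * Real.pi) : ℝ) : ℂ) + t * Complex.I)
      rw [hcos 0, bitensionRhoPoly_radius_zero, (hsin _ (hcos 0)).1] at h3
      simpa using h3) ((Real.pi / 4 : ℝ) : ℂ)
  have h2 : Real.sin (Real.pi / 4) * Real.cos (Real.pi / 4) * n ^ 2 *
      (4 * (1 - k ^ 2) - 8 * b ^ 2 + (Real.cos (Real.pi / 4) ^ 2 - Real.sin (Real.pi / 4) ^ 2)
        * n ^ 2) = 0 := by exact_mod_cast h1
  rw [Real.sin_pi_div_four, Real.cos_pi_div_four, sub_self, zero_mul, add_zero] at h2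
  have h3 : 4 * (1 - k ^ 2) - 8 * b ^ 2 ≠ 0 := by nlinarith [sq_nonneg b]
  have h4 : √2 / 2 * (√2 / 2) ≠ 0 := by positivity
  simpa [h3] using h2

/-- The derivative of `bitensionRhoPoly` along `ρ = a r + γ`, divided by `a`, at a point where
`sin r` and `sin 2ρ` vanish, in the case `b = m = 0`. -/
theorem deriv_at_symmetric_point {k a n γ r : ℝ} (ha : a ≠ 0)
    (h : ∀ r : ℝ, bitensionRhoPoly k a 0 0 n (Real.cos r) (Real.sin r)
      (Real.cos (a * r + γ)) (Real.sin (a * r + γ)) = 0)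
    (hS : Real.sin r = 0) (hX : Real.sin (2 * (a * r + γ)) = 0) :
    (k ^ 2 - 1) * Real.cos r * (k + Real.cos r)
      + n ^ 2 * Real.cos (2 * (a * r + γ)) * (4 * (k + Real.cos r) * Real.cos r
        - 4 * a ^ 2 * (k + Real.cos r) ^ 2) + n ^ 4 = 0 := by
  have hl : HasDerivAt (fun r : ℝ => 2 * (a * r + γ)) (2 * a) r := by
    simpa using (((hasDerivAt_id r).const_mul a).add_const γ).const_mul 2
  have hC' := Real.hasDerivAt_cos r
  have hS' := Real.hasDerivAt_sin r
  have hf' := hC'.const_add k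
  have hX' := hl.sin
  have hY' := hl.cos
  -- For `b = m = 0`, with `X = sin 2ρ`, `Y = cos 2ρ`, the polynomial is
  -- `a (k² - 1) S f + n² / 2 X (4 S² + 2 f C - 4 a² f²) + 2 a n² Y S f + n⁴ / 2 X Y`.
  have hd := ((((hS'.fun_mul hf').const_mul (a * (k ^ 2 - 1))).fun_add
    ((hX'.fun_mul ((((hS'.fun_pow 2).const_mul 4).fun_add ((hf'.fun_mul hC').const_mul 2)).fun_sub
      ((hf'.fun_pow 2).const_mul (4 * a ^ 2)))).const_mul (n ^ 2 / 2))).fun_add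
    ((hY'.fun_mul (hS'.fun_mul hf')).const_mul (2 * a * n ^ 2))).fun_add
    ((hX'.fun_mul hY').const_mul (n ^ 4 / 2))
  have h0 := hd.unique ((hasDerivAt_const r (0 : ℝ)).congr_of_eventuallyEq
    (Filter.Eventually.of_forall fun r => by
      have := h r
      simp only [bitensionRhoPoly] at this
      simp only [Real.sin_two_mul, Real.cos_two_mul']
      linear_combination this))
  have hY : Real.cos (2 * (a * r + γ)) ^ 2 = 1 := by
    have := Real.sin_sq_add_cos_sq (2 * (a * r + γ))
    rw [hX] at this
    linear_combination this
  rw [hS, hX] at h0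
  apply mul_left_cancel₀ ha
  linear_combination h0 - a * n ^ 4 * hY

/-- The equations `h1` and `h2` of `deriv_at_symmetric_point` at `r = π` and `r = 2π`, where
`x = n²`, `N = 2 a` and `Y` is the value of `cos 2ρ` at `r = 2π`, have no solution. For `N = ±1` the
value `cosh (N arcosh k) = k` turns the equation at the complex zeros of the radius into `hNk`. -/
theorem no_symmetric_solution {k x N : ℝ} (hk : 1 < k) (hx : 0 < x) (z : ℤ) (hN : N = z)
    (hz : z ≠ 0) {Y : ℝ} (hY : Y = 1 ∨ Y = -1) (hNk : N ^ 2 = 1 → k * x = 4 * (k ^ 2 - 1))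
    (h1 : (k ^ 2 - 1) * (-1) * (k + -1) + x * 1 * (4 * (k + -1) * (-1) - N ^ 2 * (k + -1) ^ 2)
      + x ^ 2 = 0)
    (h2 : (k ^ 2 - 1) * 1 * (k + 1) + x * Y * (4 * (k + 1) * 1 - N ^ 2 * (k + 1) ^ 2)
      + x ^ 2 = 0) : False := by
  have hκ : 0 < k ^ 2 - 1 := by nlinarith
  have hkne : k ≠ 0 := by linarith
  rcases hY with rfl | rfl
  · have e1 : (k ^ 2 - 1) + 4 * x = 2 * N ^ 2 * x := by
      apply mul_left_cancel₀ (mul_ne_zero two_ne_zero hkne)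
      linear_combination h2 - h1
    have e2 : x = N ^ 2 * (k ^ 2 - 1) := by
      apply mul_left_cancel₀ hx.ne'
      linear_combination h1 + (k - 1) * e1
    have e3 : 1 + 4 * N ^ 2 = 2 * N ^ 4 := by
      apply mul_left_cancel₀ hκ.ne'
      linear_combination e1 + (2 * N ^ 2 - 4) * e2
    rw [hN] at e3
    have e4 : 1 + 4 * z ^ 2 = 2 * z ^ 4 := by exact_mod_cast e3
    omega
  · have e1 : k * (k ^ 2 - 1) - 4 * x + N ^ 2 * x * (k ^ 2 + 1) = 0 := by
      linear_combination (h2 - h1) / 2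
    have hz1 : 1 ≤ z ^ 2 := by
      have := sq_pos_of_ne_zero hz
      omega
    rcases hz1.eq_or_lt with hz1 | hz1
    · have hN1 : N ^ 2 = 1 := by rw [hN]; exact_mod_cast hz1.symm
      have e2 := hNk hN1
      rw [hN1] at e1 h1
      have e3 : 5 * k ^ 2 = 12 := by
        apply mul_left_cancel₀ hκ.ne'
        linear_combination k * e1 - (k ^ 2 - 3) * e2
      have e4 : 16 * (k + 1) = k * (5 * k + 12) := by
        apply mul_left_cancel₀ (mul_ne_zero hκ.ne' (sub_ne_zero.mpr hk.ne'))
        linear_combination (k^2) * h1 - (k * x + 4 * (k ^ 2 - 1) - k * (k - 1) * (k + 3)) * e2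
      linarith
    · have hz2 : 4 ≤ z ^ 2 := by
        have : 2 ≤ |z| := by
          by_contra! hlt
          have : |z| ≤ 1 := by omega
          have := sq_le_one_iff_abs_le_one z |>.mpr this
          omega
        have := pow_le_pow_left₀ (by norm_num) this 2
        rw [sq_abs] at this
        omega
      have hN4 : 4 ≤ N ^ 2 := by rw [hN]; exact_mod_cast hz2
      have : 4 * x * 2 ≤ N ^ 2 * x * (k ^ 2 + 1) := by
        gcongr
        linarith
      nlinarith [mul_pos (by linarith : 0 < k) hκ]

/-! ### The case `b = 0` -/

/-- In the case `b = 0`, `n ≠ 0`, the leading coefficients at the zero `π + 2πj + i t` of the radius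
force `m = 0` and determine `2ρ = 2 (a r + γ)` there. -/
theorem double_angle_at_radius_zero {k a m n γ r₁ t : ℝ} (hk : 1 < k) (ha : a ≠ 0) (ht : 0 < t)
    (hn : n ≠ 0) (j : ℕ)
    (hcos : Complex.cos (((Real.pi + j * (2 * Real.pi) : ℝ) : ℂ) + t * Complex.I) = -k)
    (hsin : ∀ z : ℂ, Complex.cos z = -k → Complex.sin z ^ 2 = 1 - k ^ 2 ∧ Complex.sin z ≠ 0)
    (h : ∀ᶠ r : ℝ in nhds r₁, bitensionRhoPoly k a 0 m n (Real.cos r) (Real.sin r)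
      (Real.cos (a * r + γ)) (Real.sin (a * r + γ)) = 0)
    (h' : ∀ᶠ r : ℝ in nhds r₁, bitensionPhiPoly k a m n (Real.cos r) (Real.sin r)
      (Real.cos (a * r + γ)) (Real.sin (a * r + γ)) = 0) :
    m = 0 ∧ Real.cos (2 * (a * (Real.pi + j * (2 * Real.pi)) + γ)) = 1 ∧
      Real.cosh (2 * a * t) * n ^ 2 = 4 * (k ^ 2 - 1) := by
  set z : ℂ := ((Real.pi + j * (2 * Real.pi) : ℝ) : ℂ) + t * Complex.I with hz
  have h1 := bitensionRhoPoly_complex_eq_zero h z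
  have h2 := bitensionPhiPoly_complex_eq_zero h' z
  obtain ⟨hS, hS0⟩ := hsin z hcos
  rw [hcos, bitensionRhoPoly_radius_zero, hS] at h1
  rw [hcos, bitensionPhiPoly_radius_zero] at h2
  set w : ℂ := a * z + γ with hw
  set X : ℝ := 2 * (a * (Real.pi + j * (2 * Real.pi)) + γ) with hX
  have h2w : 2 * w = (X : ℂ) + ((2 * a * t : ℝ) : ℂ) * Complex.I := by
    rw [hw, hz, hX]; push_cast; ring
  have hat : 2 * a * t ≠ 0 := by positivity
  -- The zeros of the complex sine are real, and `2 w` is not.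
  have hs2 : Complex.sin (2 * w) ≠ 0 := by
    intro h0
    obtain ⟨i, hi⟩ := Complex.sin_eq_zero_iff.mp h0
    have := congrArg Complex.im (h2w.symm.trans hi)
    simp at this
    aesop
  rw [Complex.sin_two_mul] at hs2
  have hs0 : Complex.sin w ≠ 0 := fun h => hs2 (by simp [h])
  have hc0 : Complex.cos w ≠ 0 := fun h => hs2 (by simp [h])
  have hn' : (n : ℂ) ≠ 0 := by exact_mod_cast hn
  have h3 : Complex.cos (2 * w) * n ^ 2 = 4 * (k ^ 2 - 1) := by
    have := (mul_eq_zero.mp h1).resolve_left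
      (mul_ne_zero (mul_ne_zero hs0 hc0) (pow_ne_zero 2 hn'))
    rw [Complex.cos_two_mul']
    push_cast at this
    linear_combination this
  have h4 : ((Real.cos X * Real.cosh (2 * a * t) * n ^ 2 : ℝ) : ℂ) -
      ((Real.sin X * Real.sinh (2 * a * t) * n ^ 2 : ℝ) : ℂ) * Complex.I =
        ((4 * (k ^ 2 - 1) : ℝ) : ℂ) := by
    rw [h2w, Complex.cos_add_mul_I] at h3
    push_cast at h3 ⊢
    linear_combination h3
  have hre : Real.cos X * Real.cosh (2 * a * t) * n ^ 2 = 4 * (k ^ 2 - 1) := by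
    have := congrArg Complex.re h4
    rwa [Complex.sub_re, Complex.re_ofReal_mul, Complex.I_re, mul_zero, sub_zero,
      Complex.ofReal_re, Complex.ofReal_re] at this
  have him : Real.sin X * Real.sinh (2 * a * t) * n ^ 2 = 0 := by
    have := congrArg Complex.im h4
    rwa [Complex.sub_im, Complex.im_ofReal_mul, Complex.I_im, mul_one,
      Complex.ofReal_im, Complex.ofReal_im, zero_sub, neg_eq_zero] at this
  have hsX : Real.sin X = 0 := by
    have : Real.sinh (2 * a * t) ≠ 0 := by simpa using hat
    simpa [hn, this] using him
  have hn2 : 0 < n ^ 2 := by positivity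
  have hcX : Real.cos X = 1 := by
    have hpos : 0 < Real.cos X := by
      by_contra! hle
      have : Real.cos X * Real.cosh (2 * a * t) * n ^ 2 ≤ 0 :=
        mul_nonpos_of_nonpos_of_nonneg
          (mul_nonpos_of_nonpos_of_nonneg hle (Real.cosh_pos _).le) hn2.le
      nlinarith
    have := Real.sin_sq_add_cos_sq X
    rw [hsX] at this
    nlinarith
  rw [hcX, one_mul] at hre
  refine ⟨?_, hcX, hre⟩
  -- For `m ≠ 0` the second polynomial gives `n² = 5 (k² - 1)`, hence `cosh (2 a t) = 4 / 5 < 1`.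
  by_contra hm
  have hm' : (m : ℂ) ≠ 0 := by exact_mod_cast hm
  have h5 := (mul_eq_zero.mp h2).resolve_left (mul_ne_zero (mul_ne_zero hc0 hm') hS0)
  have h6 : (n : ℂ) ^ 2 = 5 * (k ^ 2 - 1) := by
    rw [Complex.cos_two_mul'] at h3
    have := Complex.sin_sq_add_cos_sq w
    linear_combination h3 - h5 - (n : ℂ) ^ 2 * this
  have h7 : n ^ 2 = 5 * (k ^ 2 - 1) := by exact_mod_cast h6
  have := Real.one_le_cosh (2 * a * t)
  nlinarith

theorem n_eq_zero_of_b_zero {k a m n γ r₁ : ℝ} (hk : 1 < k) (ha : a ≠ 0)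
    (h : ∀ᶠ r : ℝ in nhds r₁, bitensionRhoPoly k a 0 m n (Real.cos r) (Real.sin r)
      (Real.cos (a * r + γ)) (Real.sin (a * r + γ)) = 0)
    (h' : ∀ᶠ r : ℝ in nhds r₁, bitensionPhiPoly k a m n (Real.cos r) (Real.sin r)
      (Real.cos (a * r + γ)) (Real.sin (a * r + γ)) = 0) : n = 0 := by
  by_contra hn
  obtain ⟨t, ht, hkt, hcos, hsin⟩ := exists_cos_eq_neg hk
  obtain ⟨rfl, hX0, hcosh⟩ := double_angle_at_radius_zero hk ha ht hn 0 (hcos 0) hsin h h'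
  obtain ⟨-, hX1, -⟩ := double_angle_at_radius_zero hk ha ht hn 1 (hcos 1) hsin h h'
  have hreal (r : ℝ) : bitensionRhoPoly k a 0 0 n (Real.cos r) (Real.sin r)
      (Real.cos (a * r + γ)) (Real.sin (a * r + γ)) = 0 := by
    have := bitensionRhoPoly_complex_eq_zero h r
    rw [← Complex.ofReal_inj]
    simpa [bitensionRhoPoly] using this
  obtain ⟨p, hp⟩ := (Real.cos_eq_one_iff _).mp hX0
  obtain ⟨q, hq⟩ := (Real.cos_eq_one_iff _).mp hX1
  push_cast at hp hq
  -- Consecutive zeros of the radius differ by `2π`, and `2ρ` changes by `4πa` between them.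
  have hN : 2 * a = ((q - p : ℤ) : ℝ) := by
    apply mul_left_cancel₀ (mul_ne_zero two_ne_zero Real.pi_ne_zero)
    push_cast
    linear_combination hp - hq
  have hx0 : 2 * (a * Real.pi + γ) = p * (2 * Real.pi) := by linear_combination -hp
  have hx1 : 2 * (a * (2 * Real.pi) + γ) = ((q - p : ℤ) : ℝ) * Real.pi + p * (2 * Real.pi) := by
    rw [← hN]; linear_combination -hp
  have hs1 : Real.sin (2 * (a * (2 * Real.pi) + γ)) = 0 := by
    rw [hx1, Real.sin_add_int_mul_two_pi, Real.sin_int_mul_pi]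
  have e0 := deriv_at_symmetric_point ha hreal Real.sin_pi (by
    rw [hx0, ← zero_add (_ * _), Real.sin_add_int_mul_two_pi, Real.sin_zero])
  have e1 := deriv_at_symmetric_point ha hreal Real.sin_two_pi hs1
  have hc0 : Real.cos (2 * (a * Real.pi + γ)) = 1 := by
    rw [hx0, ← zero_add (_ * _), Real.cos_add_int_mul_two_pi, Real.cos_zero]
  rw [Real.cos_pi, hc0] at e0
  rw [Real.cos_two_pi] at e1
  refine no_symmetric_solution (x := n ^ 2) (N := 2 * a) hk (by positivity) (q - p) hN ?_
    (Y := Real.cos (2 * (a * (2 * Real.pi) + γ))) ?_ ?_ ?_ ?_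
  · intro h0
    rw [h0] at hN
    simp [ha] at hN
  · have := Real.sin_sq_add_cos_sq (2 * (a * (2 * Real.pi) + γ))
    rw [hs1] at this
    exact mul_self_eq_one_iff.mp (by linear_combination this)
  · intro h1
    have : Real.cosh (2 * a * t) = k := by
      rcases mul_self_eq_one_iff.mp ((sq _).symm.trans h1) with h1 | h1 <;> simp [h1, hkt]
    rw [← hcosh, this]
  · linear_combination e0
  · linear_combination e1

/-! ### The vanishing of the polynomials for a biharmonic map -/

/-- As `a ≠ 0`, the map does not send an open set into the poles of the polar coordinates. -/
theorem exists_mem_cos_ne_zero {a b c : ℝ} (ha : a ≠ 0) {W : Set (Coord 2)} (hW : IsOpen W)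
    (hW' : W.Nonempty) : ∃ x ∈ W, Real.cos (a * x 0 + b * x 1 + c) ≠ 0 := by
  obtain ⟨x, hx⟩ := hW'
  by_contra! hall
  have hcont : Continuous fun t : ℝ => (![x 0 + t, x 1] : Coord 2) := by
    fun_prop
  have hx0 : (![x 0 + 0, x 1] : Coord 2) = x := by
    ext i; fin_cases i <;> simp
  have hev : ∀ᶠ t : ℝ in nhds 0, Real.cos (a * (x 0 + t) + b * x 1 + c) = 0 := by
    have : ∀ᶠ t : ℝ in nhds 0, (![x 0 + t, x 1] : Coord 2) ∈ W :=
      hcont.continuousAt.eventually_mem (by rw [hx0]; exact hW.mem_nhds hx)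
    filter_upwards [this] with t ht
    simpa using hall _ ht
  have hd : HasDerivAt (fun t : ℝ => Real.cos (a * (x 0 + t) + b * x 1 + c))
      (-Real.sin (a * (x 0 + 0) + b * x 1 + c) * a) 0 := by
    have hl : HasDerivAt (fun t : ℝ => a * (x 0 + t) + b * x 1 + c) a 0 := by
      simpa using (((((hasDerivAt_id (0 : ℝ)).const_add (x 0)).const_mul a).add_const
        (b * x 1)).add_const c)
    exact hl.cos
  have h0 := hd.unique ((hasDerivAt_const (0 : ℝ) (0 : ℝ)).congr_of_eventuallyEq hev)
  have hs : Real.sin (a * (x 0 + 0) + b * x 1 + c) = 0 := by simpa [ha] using h0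
  have := Real.sin_sq_add_cos_sq (a * (x 0 + 0) + b * x 1 + c)
  rw [hs, hev.self_of_nhds] at this
  norm_num at this

theorem polys_eq_zero_of_isBiharmonicOn {k : ℝ} (hk : 1 < k) {a b c m n l : ℝ}
    {W : Set (Coord 2)} (hW : IsOpen W) {F : Torus → Sphere2}
    (hF : ∀ x ∈ W, F (toTorus x) = polarPoint (a * x 0 + b * x 1 + c) (m * x 0 + n * x 1 + l))
    (h : IsBiharmonicOn (torusMetric k) F (toTorus '' W)) {x : Coord 2} (hx : x ∈ W)
    (h0 : Real.cos (a * x 0 + b * x 1 + c) ≠ 0) :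
    bitensionRhoPoly k a b m n (Real.cos (x 0)) (Real.sin (x 0))
      (Real.cos (a * x 0 + b * x 1 + c)) (Real.sin (a * x 0 + b * x 1 + c)) = 0 ∧
    (b = 0 → bitensionPhiPoly k a m n (Real.cos (x 0)) (Real.sin (x 0))
      (Real.cos (a * x 0 + b * x 1 + c)) (Real.sin (a * x 0 + b * x 1 + c)) = 0) := by
  have hu : ContDiff ℝ ∞ (affineCoordMap a b c m n l) := by
    rw [contDiff_pi]
    intro i
    fin_cases i <;> simp [affineCoordMap] <;> fun_prop
  have hU : IsOpen (W ∩ {x | Real.cos (a * x 0 + b * x 1 + c) ≠ 0}) :=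
    hW.inter (isOpen_ne_fun (Real.continuous_cos.comp (by fun_prop)) continuous_const)
  have h1 := h.2 _ _ isSphereParam_polarPoint _ (affineCoordMap a b c m n l) hU
    (fun y hy => ⟨y, hy.1, rfl⟩) hu.contDiffOn (fun y hy => hy.2)
    (fun y hy => by rw [hF y hy.1]; rfl) x ⟨hx, h0⟩
  rw [inducedMetric_polarPoint] at h1
  have hf : k + Real.cos (x 0) ≠ 0 := by linarith [Real.neg_one_le_cos (x 0)]
  have h2 := bitension_affineCoordMap_eq (m := m) (n := n) (l := l) rfl hf h0
  rw [h1] at h2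
  simp only [Pi.zero_apply, mul_zero] at h2
  exact ⟨h2.1.symm, fun hb => (h2.2 hb).symm⟩

end BiharmonicTorus

end

/-- The metric on the torus is `dr² + (k + cos r)² dθ²`, `k > 1`. The map `F` has the form
`(r, θ) ↦ (ρ, φ) = (a r + b θ + c, m r + n θ + l)` over a nonempty open set `W` of coordinates; `W`
is the whole plane for a map given by this formula on all of the torus, and a smaller `W` admits
parameters for which the formula defines a map only on a part of the torus. -/
theorem corollary4p2 (k : ℝ) (hk : 1 < k) (a b c m n l : ℝ) (ha : a ≠ 0)
    (W : Set (BiharmonicTorus.Coord 2)) (hW : IsOpen W) (hW' : W.Nonempty)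
    (F : BiharmonicTorus.Torus → BiharmonicTorus.Sphere2)
    (hF : ∀ x ∈ W, F (BiharmonicTorus.toTorus x) =
      BiharmonicTorus.polarPoint (a * x 0 + b * x 1 + c) (m * x 0 + n * x 1 + l)) :
    ¬ BiharmonicTorus.IsBiharmonicOn (BiharmonicTorus.torusMetric k) F
      (BiharmonicTorus.toTorus '' W) := by
  intro h
  obtain ⟨x, hx, h0⟩ := BiharmonicTorus.exists_mem_cos_ne_zero (b := b) (c := c) ha hW hW'
  have key {y : BiharmonicTorus.Coord 2} (hy : y ∈ W)
      (h0 : Real.cos (a * y 0 + b * y 1 + c) ≠ 0) :=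
    BiharmonicTorus.polys_eq_zero_of_isBiharmonicOn hk hW hF h hy h0
  have hU : IsOpen (W ∩ {x | Real.cos (a * x 0 + b * x 1 + c) ≠ 0}) :=
    hW.inter (isOpen_ne_fun (Real.continuous_cos.comp (by fun_prop)) continuous_const)
  rcases eq_or_ne b 0 with rfl | hb
  · have hcont : Continuous fun r : ℝ => (![r, x 1] : BiharmonicTorus.Coord 2) := by fun_prop
    have hx1 : (![x 0, x 1] : BiharmonicTorus.Coord 2) = x := by
      ext i; fin_cases i <;> simp
    have hev : ∀ᶠ r : ℝ in nhds (x 0), (![r, x 1] : BiharmonicTorus.Coord 2) ∈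
        W ∩ {x | Real.cos (a * x 0 + 0 * x 1 + c) ≠ 0} :=
      hcont.continuousAt.eventually_mem (by rw [hx1]; exact hU.mem_nhds ⟨hx, h0⟩)
    have h1 := hev.mono fun r hr => (key hr.1 hr.2).1
    have h2 := hev.mono fun r hr => (key hr.1 hr.2).2 rfl
    simp only [Matrix.cons_val_zero, zero_mul, add_zero] at h1 h2
    exact BiharmonicTorus.n_ne_zero hk ha h1
      (BiharmonicTorus.n_eq_zero_of_b_zero hk ha h1 h2)
  -- The segments with `ρ` fixed are used, parametrized by `r`; `θ` is then `(ρ - c - a r) / b`.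
  · have hcont : Continuous fun q : ℝ × ℝ =>
        (![q.2, (q.1 - c - a * q.2) / b] : BiharmonicTorus.Coord 2) := by fun_prop
    have hx1 : (![x 0, ((a * x 0 + b * x 1 + c) - c - a * x 0) / b] : BiharmonicTorus.Coord 2)
        = x := by
      ext i
      fin_cases i
      · simp
      · simp
        field_simp
    have hev : ∀ᶠ q : ℝ × ℝ in nhds (a * x 0 + b * x 1 + c, x 0),
        BiharmonicTorus.bitensionRhoPoly k a b m n (Real.cos q.2) (Real.sin q.2) (Real.cos q.1)
          (Real.sin q.1) = 0 := by
      have hmem : ∀ᶠ q : ℝ × ℝ in nhds (a * x 0 + b * x 1 + c, x 0),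
          (![q.2, (q.1 - c - a * q.2) / b] : BiharmonicTorus.Coord 2) ∈
            W ∩ {x | Real.cos (a * x 0 + b * x 1 + c) ≠ 0} :=
        hcont.continuousAt.eventually_mem (by rw [hx1]; exact hU.mem_nhds ⟨hx, h0⟩)
      filter_upwards [hmem] with q hq
      have hρ : a * q.2 + b * ((q.1 - c - a * q.2) / b) + c = q.1 := by
        field_simp
        ring
      simpa [hρ] using (key hq.1 hq.2).1
    rw [nhds_prod_eq] at hev
    have hev' := hev.curry
    exact BiharmonicTorus.n_ne_zero (α := 0) (γ := a * x 0 + b * x 1 + c) hk ha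
      (by simpa using hev'.self_of_nhds)
      (BiharmonicTorus.n_eq_zero_of_independent hk hev')
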